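/- Let $Q_4$ be the $4$-cube with vertex set $\{1,\dots,16\}$, where the vertices $1,\dots,16$ stand for the subsets $\emptyset$, $a$, $b$, $c$, $d$, $ab$, $ac$, $bc$, $ad$, $bd$, $cd$, $abc$, $abd$, $acd$, $bcd$, $abcd$ of $\{a,b,c,d\}$ in this order, and two vertices are adjacent if the subsets differ in exactly one element. Let $\tilde Q_4$ be the switched $4$-cube, obtained from $Q_4$ by Godsil–McKay switching with respect to the partition $C_1=\{1\}$, $C_2=\{6,\dots,11\}$, $C_3=\{12,\dots,15\}$, $C_4=\{16\}$, $D=\{2,3,4,5\}$; that is, whenever $v\in D$ is adjacent to exactly half of the vertices of some $C_i$, the edges from $v$ to these are deleted and $v$ is joined instead to the other half of $C_i$. Let $A_{4,1}$ and $A_{4,2}$ be the adjacency matrices of $Q_4$ and $\tilde Q_4$, and let $$A_{5,3}=\begin{bmatrix}A_{4,1}&I\\ I&A_{4,2}\end{bmatrix},$$ with $I$ the $16\times16$ identity matrix, be the adjacency matrix of the partially switched $5$-cube, with vertex set $\{1,\dots,32\}$. A vertex $j$ has perfect state transfer (PST) if there are a vertex $k\ne j$ and a time $t\in\mathbb R$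 with $\left|\left(e^{itA_{5,3}}\right)_{jk}\right|^2=1$. Then the set of vertices with PST is exactly $\{1,16,17,32\}$; that is, exactly $1/8$ of the vertices have PST. -/

import Mathlib

/-- The `n`-cube graph: two bit strings are adjacent when they differ in exactly one place. -/
def hypercube (n : ℕ) : SimpleGraph (Fin n → Bool) where
  Adj x y := hammingDist x y = 1
  symm := ⟨fun x y h => by rw [hammingDist_comm]; exact h⟩
  loopless := ⟨fun x h => by simp at h⟩

instance (n : ℕ) : DecidableRel (hypercube n).Adj :=
  fun x y => inferInstanceAs (Decidable (hammingDist x y = 1))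

/-- The labelling of the vertices of the 4-cube: vertex number `j + 1` is the bit string of the
`j`-th number in this list (bit strings in order of weight, then of the number they encode). -/
def cubeLabel (j : Fin 16) : Fin 4 → Bool :=
  fun b => ((![0, 1, 2, 4, 8, 3, 5, 6, 9, 10, 12, 7, 11, 13, 14, 15] : Fin 16 → ℕ) j).testBit b

theorem cubeLabel_bijective : Function.Bijective cubeLabel := by
  decide +kernel

/-- The 4-cube on the vertices `1, …, 16`; the vertex number `j + 1` is `j : Fin 16`. -/
def Q4 : SimpleGraph (Fin 16) := (hypercube 4).comap cubeLabel

instance : DecidableRel Q4.Adj :=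
  fun i j => inferInstanceAs (Decidable ((hypercube 4).Adj (cubeLabel i) (cubeLabel j)))

/-- In Godsil-McKay switching with cells `C i` and `D`, the pair `v, w` is changed if `v` lies in
`D`, `w` lies in some `C i`, and `v` is adjacent to exactly half of the vertices of `C i`. -/
def GMFlip {V ι : Type*} (G : SimpleGraph V) [DecidableRel G.Adj]
    (C : ι → Finset V) (D : Finset V) (v w : V) : Prop :=
  v ∈ D ∧ ∃ i, w ∈ C i ∧ 2 * ((C i).filter (fun x => G.Adj v x)).card = (C i).card

instance {V ι : Type*} [DecidableEq V] [Fintype ι] (G : SimpleGraph V) [DecidableRel G.Adj]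
    (C : ι → Finset V) (D : Finset V) : DecidableRel (GMFlip G C D) :=
  fun v w => inferInstanceAs (Decidable
    (v ∈ D ∧ ∃ i, w ∈ C i ∧ 2 * ((C i).filter (fun x => G.Adj v x)).card = (C i).card))

/-- Godsil-McKay switching of `G` with respect to the partition with cells `C i` and `D`: edges
and non-edges are exchanged for the pairs that are changed, all other pairs are kept. -/
def gmSwitch {V ι : Type*} (G : SimpleGraph V) [DecidableRel G.Adj]
    (C : ι → Finset V) (D : Finset V) : SimpleGraph V where
  Adj v w := v ≠ w ∧ Xor (G.Adj v w) (GMFlip G C D v w ∨ GMFlip G C D w v)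
  symm := ⟨fun v w h => ⟨h.1.symm, by rw [G.adj_comm, or_comm]; exact h.2⟩⟩
  loopless := ⟨fun v h => h.1 rfl⟩

instance {V ι : Type*} [DecidableEq V] [Fintype ι] (G : SimpleGraph V) [DecidableRel G.Adj]
    (C : ι → Finset V) (D : Finset V) : DecidableRel (gmSwitch G C D).Adj :=
  fun v w => inferInstanceAs (Decidable
    (v ≠ w ∧ ((G.Adj v w ∧ ¬ (GMFlip G C D v w ∨ GMFlip G C D w v)) ∨
      ((GMFlip G C D v w ∨ GMFlip G C D w v) ∧ ¬ G.Adj v w))))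

/-- The cells `{1}`, `{6, …, 11}`, `{12, …, 15}`, `{16}` (vertex numbers). -/
def cellsC : Fin 4 → Finset (Fin 16) :=
  ![{0}, {5, 6, 7, 8, 9, 10}, {11, 12, 13, 14}, {15}]

/-- The cell `{2, 3, 4, 5}` (vertex numbers). -/
def cellD : Finset (Fin 16) := {1, 2, 3, 4}

/-- The switched 4-cube. -/
def switchedQ4 : SimpleGraph (Fin 16) := gmSwitch Q4 cellsC cellD

instance : DecidableRel switchedQ4.Adj :=
  inferInstanceAs (DecidableRel (gmSwitch Q4 cellsC cellD).Adj)

/-- The adjacency matrix of the 4-cube. -/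
def A41 : Matrix (Fin 16) (Fin 16) ℂ := Q4.adjMatrix ℂ

/-- The adjacency matrix of the switched 4-cube. -/
def A42 : Matrix (Fin 16) (Fin 16) ℂ := switchedQ4.adjMatrix ℂ

/-- The adjacency matrix of the partially switched 5-cube. Vertex `j` of the first block and
vertex `j` of the second block become `j` and `16 + j`; vertex number `v + 1` is `v : Fin 32`. -/
def A53 : Matrix (Fin 32) (Fin 32) ℂ :=
  Matrix.reindex finSumFinEquiv finSumFinEquiv (Matrix.fromBlocks A41 1 1 A42)

/-- The fidelity of state transfer `|⟨j| exp(i t H) |k⟩|²`. -/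
noncomputable def fidelity {V : Type*} [Fintype V] [DecidableEq V] (H : Matrix V V ℂ)
    (j k : V) (t : ℝ) : ℝ :=
  ‖NormedSpace.exp ((Complex.I * (t : ℂ)) • H) j k‖ ^ 2

/-- Perfect state transfer between two different vertices. -/
def HasPST {V : Type*} [Fintype V] [DecidableEq V] (H : Matrix V V ℂ) (j k : V) : Prop :=
  j ≠ k ∧ ∃ t : ℝ, fidelity H j k t = 1

/-- The set of vertices that have perfect state transfer with some other vertex. -/
def pstVertices {V : Type*} [Fintype V] [DecidableEq V] (H : Matrix V V ℂ) : Set V :=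
  {j | ∃ k, HasPST H j k}

/-!
An amplitude that depends only on the distance from a vertex of a cube evolves as a product over
the coordinates, each contributing `cos t` or `i sin t`, so at time `π / 2` it is concentrated at
the opposite vertex. Switching keeps the number of neighbours that a vertex has on the levels below
and above its own, whence PST between vertices `1` and `32`, and, measuring distances from the full
set, between vertices `16` and `17`.

Conversely, PST at `j` forces the differences of the eigenvalues having an eigenvector that does
not vanish at `j` to be rational multiples of each other. For every `j` these eigenvalues include
`5` and `-5`, hence they are rational and, the matrix being integral, integers. At every vertex
apart from the four above there is a violation: `x ↦ ∑_{s ∈ x} c s`, with `∑ c s = 0` and no other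
vanishing nonempty subset sum, can be rescaled on each level of the two blocks to an eigenvector
whose eigenvalue lies between `0` and `1 / 4`.
-/

open Matrix

section QuantumWalk

variable {V : Type*} [Fintype V] [DecidableEq V]

/-- The transition matrix `exp (i t H)` of the continuous-time quantum walk with Hamiltonian `H`. -/
noncomputable def transitionMatrix (H : Matrix V V ℂ) (t : ℝ) : Matrix V V ℂ :=
  NormedSpace.exp ((Complex.I * (t : ℂ)) • H)

/-- The eigenvalue support of the vertex `j`: the real eigenvalues of `H` having an eigenvector
that does not vanish at `j`. -/
def eigenvalueSupport (H : Matrix V V ℂ) (j : V) : Set ℝ :=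
  {μ | ∃ w : V → ℂ, H *ᵥ w = (μ : ℂ) • w ∧ w j ≠ 0}

theorem fidelity_eq_norm_transitionMatrix_sq (H : Matrix V V ℂ) (j k : V) (t : ℝ) :
    fidelity H j k t = ‖transitionMatrix H t j k‖ ^ 2 :=
  rfl

@[simp]
theorem transitionMatrix_zero (H : Matrix V V ℂ) : transitionMatrix H 0 = 1 := by
  simp [transitionMatrix]

theorem isSymm_transitionMatrix {H : Matrix V V ℂ} (hS : H.IsSymm) (t : ℝ) :
    (transitionMatrix H t).IsSymm :=
  (hS.smul _).exp

open scoped Matrix.Norms.L2Operator in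
theorem transitionMatrix_mem_unitaryGroup {H : Matrix V V ℂ} (hH : H.IsHermitian) (t : ℝ) :
    transitionMatrix H t ∈ unitaryGroup V ℂ := by
  have htH : IsSelfAdjoint ((t : ℂ) • H) := IsSelfAdjoint.smul (Complex.conj_ofReal t) hH
  rw [transitionMatrix, mul_smul]
  exact (selfAdjoint.expUnitary ⟨(t : ℂ) • H, htH⟩).2

open scoped Matrix.Norms.Operator in
theorem hasDerivAt_transitionMatrix_mulVec (H : Matrix V V ℂ) (w : V → ℂ) (t : ℝ) :
    HasDerivAt (fun s => transitionMatrix H s *ᵥ w)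
      ((Complex.I • H) *ᵥ (transitionMatrix H t *ᵥ w)) t := by
  have hexp : HasDerivAt (transitionMatrix H) (Complex.I • H * transitionMatrix H t) t := by
    have hsmul (s : ℝ) : transitionMatrix H s = NormedSpace.exp (s • (Complex.I • H)) := by
      rw [transitionMatrix, ← Complex.coe_smul, smul_smul, mul_comm]
    rw [hsmul, funext hsmul]
    exact hasDerivAt_exp_smul_const' (𝕂 := ℝ) (Complex.I • H) t
  rw [mulVec_mulVec]
  exact ((mulVecBilin ℝ ℝ).flip w).toContinuousLinearMap.hasFDerivAt.comp_hasDerivAt t hexp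

theorem transitionMatrix_mulVec_eq_of_hasDerivAt {H : Matrix V V ℂ} {ψ : ℝ → V → ℂ}
    (hψ : ∀ t, HasDerivAt ψ ((Complex.I • H) *ᵥ ψ t) t) (t : ℝ) :
    transitionMatrix H t *ᵥ ψ 0 = ψ t := by
  have hlip := (mulVecLin (Complex.I • H)).toContinuousLinearMap.lipschitz
  exact congrFun (ODE_solution_unique_univ (t₀ := 0) (s := fun _ => Set.univ)
    (fun _ => hlip.lipschitzOnWith)
    (fun s => ⟨hasDerivAt_transitionMatrix_mulVec H (ψ 0) s, Set.mem_univ _⟩)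
    (fun s => ⟨hψ s, Set.mem_univ _⟩) (by simp)) t

theorem transitionMatrix_mulVec_of_eigenvector {H : Matrix V V ℂ} {w : V → ℂ} {μ : ℂ}
    (hw : H *ᵥ w = μ • w) (t : ℝ) :
    transitionMatrix H t *ᵥ w = Complex.exp (Complex.I * t * μ) • w := by
  have hψ (s : ℝ) : HasDerivAt (fun s : ℝ => Complex.exp (Complex.I * s * μ) • w)
      ((Complex.I • H) *ᵥ (Complex.exp (Complex.I * s * μ) • w)) s := by
    have harg : HasDerivAt (fun s : ℝ => Complex.I * (s : ℂ) * μ) (Complex.I * μ) s := by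
      simpa using ((Complex.ofRealCLM.hasDerivAt (x := s)).const_mul Complex.I).mul_const μ
    convert! harg.cexp.smul_const w using 1
    rw [mulVec_smul, smul_mulVec, hw, smul_smul, smul_smul, mul_assoc]
  simpa using transitionMatrix_mulVec_eq_of_hasDerivAt hψ t

theorem sum_norm_sq_row_of_mem_unitaryGroup {𝕜 : Type*} [RCLike 𝕜] {U : Matrix V V 𝕜}
    (hU : U ∈ unitaryGroup V 𝕜) (j : V) : ∑ i, ‖U j i‖ ^ 2 = 1 := by
  have hjj : (U * star U) j j = 1 := by rw [mem_unitaryGroup_iff.mp hU, one_apply_eq]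
  simp only [mul_apply, star_apply, RCLike.star_def, RCLike.mul_conj] at hjj
  exact_mod_cast hjj

theorem mulVec_apply_of_mem_unitaryGroup_of_norm_eq_one {𝕜 : Type*} [RCLike 𝕜]
    {U : Matrix V V 𝕜} (hU : U ∈ unitaryGroup V 𝕜) {j k : V} (hjk : ‖U j k‖ = 1) (w : V → 𝕜) :
    (U *ᵥ w) j = U j k * w k := by
  have hoff : ∑ i ∈ Finset.univ.erase k, ‖U j i‖ ^ 2 = 0 := by
    have hrow := sum_norm_sq_row_of_mem_unitaryGroup hU j
    rw [← Finset.add_sum_erase _ _ (Finset.mem_univ k), hjk] at hrow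
    linarith
  have hzero (i : V) (hik : i ≠ k) : U j i = 0 := by
    simpa using (Finset.sum_eq_zero_iff_of_nonneg fun i _ => sq_nonneg ‖U j i‖).mp hoff i
      (Finset.mem_erase.mpr ⟨hik, Finset.mem_univ i⟩)
  rw [mulVec, dotProduct, Fintype.sum_eq_single k fun i hik => by rw [hzero i hik, zero_mul]]

theorem HasPST.symm {H : Matrix V V ℂ} (hS : H.IsSymm) {j k : V} (h : HasPST H j k) :
    HasPST H k j := by
  obtain ⟨hjk, t, ht⟩ := h
  refine ⟨hjk.symm, t, ?_⟩
  rwa [fidelity_eq_norm_transitionMatrix_sq, (isSymm_transitionMatrix hS t).apply j k]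

theorem fidelity_reindex {W : Type*} [Fintype W] [DecidableEq W] (e : V ≃ W)
    (H : Matrix V V ℂ) (j k : V) (t : ℝ) :
    fidelity (reindex e e H) (e j) (e k) t = fidelity H j k t := by
  have hexp : reindex e e (transitionMatrix H t) = transitionMatrix (reindex e e H) t := by
    open scoped Matrix.Norms.Operator in
    exact NormedSpace.map_exp (reindexAlgEquiv ℂ ℂ e)
      (continuous_id.matrix_reindex e e) ((Complex.I * (t : ℂ)) • H)
  rw [fidelity_eq_norm_transitionMatrix_sq, ← hexp, reindex_apply, submatrix_apply,
    e.symm_apply_apply, e.symm_apply_apply, fidelity_eq_norm_transitionMatrix_sq]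

theorem pstVertices_reindex {W : Type*} [Fintype W] [DecidableEq W] (e : V ≃ W)
    (H : Matrix V V ℂ) : pstVertices (reindex e e H) = e '' pstVertices H := by
  have hiff (j k : V) : HasPST (reindex e e H) (e j) (e k) ↔ HasPST H j k := by
    simp only [HasPST, fidelity_reindex, ne_eq, e.apply_eq_iff_eq]
  ext x
  obtain ⟨j, rfl⟩ := e.surjective x
  simp only [pstVertices, Set.mem_ofPred_eq, e.injective.mem_set_image,
    ← e.exists_congr_right, hiff]

end QuantumWalk

section RatioCondition

variable {V : Type*} [Fintype V] [DecidableEq V] {H : Matrix V V ℂ} {j k : V}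

/- Since `w` is an eigenvector, `e^{itμ} w j = U j k * w k`, and by symmetry of `U` the same holds
with `j` and `k` exchanged. -/
theorem exp_two_mul_eq_transitionMatrix_sq (hH : H.IsHermitian) (hS : H.IsSymm) {t : ℝ}
    (ht : fidelity H j k t = 1) {μ : ℝ} (hμ : μ ∈ eigenvalueSupport H j) :
    Complex.exp (2 * (Complex.I * t * μ)) = transitionMatrix H t j k ^ 2 := by
  obtain ⟨w, hw, hwj⟩ := hμ
  have hU := transitionMatrix_mem_unitaryGroup hH t
  have hUw := transitionMatrix_mulVec_of_eigenvector hw t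
  have hsymm := (isSymm_transitionMatrix hS t).apply j k
  have hnorm : ‖transitionMatrix H t j k‖ = 1 := by
    rwa [fidelity_eq_norm_transitionMatrix_sq,
      pow_eq_one_iff_of_nonneg (norm_nonneg _) two_ne_zero] at ht
  have hj := mulVec_apply_of_mem_unitaryGroup_of_norm_eq_one hU hnorm w
  have hk := mulVec_apply_of_mem_unitaryGroup_of_norm_eq_one hU (hsymm ▸ hnorm) w
  rw [hUw, Pi.smul_apply, smul_eq_mul] at hj hk
  rw [hsymm] at hk
  rw [two_mul, Complex.exp_add]
  apply mul_right_cancel₀ hwj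
  linear_combination Complex.exp (Complex.I * t * μ) * hj + transitionMatrix H t j k * hk

theorem exists_int_mul_sub_eq_mul_pi (hH : H.IsHermitian) (hS : H.IsSymm) {t : ℝ}
    (ht : fidelity H j k t = 1) {a b : ℝ} (ha : a ∈ eigenvalueSupport H j)
    (hb : b ∈ eigenvalueSupport H j) : ∃ n : ℤ, t * (a - b) = n * Real.pi := by
  have hexp := (exp_two_mul_eq_transitionMatrix_sq hH hS ht ha).trans
    (exp_two_mul_eq_transitionMatrix_sq hH hS ht hb).symm
  obtain ⟨n, hn⟩ := Complex.exp_eq_exp_iff_exists_int.mp hexp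
  refine ⟨n, ?_⟩
  have hcast : (t : ℂ) * (a - b) = n * Real.pi := by
    apply mul_left_cancel₀ (mul_ne_zero two_ne_zero Complex.I_ne_zero)
    linear_combination hn
  exact_mod_cast hcast

theorem HasPST.exists_rat_sub_eq_mul_sub (hH : H.IsHermitian) (hS : H.IsSymm) (h : HasPST H j k)
    {a b c d : ℝ} (ha : a ∈ eigenvalueSupport H j) (hb : b ∈ eigenvalueSupport H j)
    (hc : c ∈ eigenvalueSupport H j) (hd : d ∈ eigenvalueSupport H j) (hcd : c ≠ d) :
    ∃ q : ℚ, a - b = q * (c - d) := by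
  obtain ⟨hjk, t, ht⟩ := h
  have ht₀ : t ≠ 0 := by
    rintro rfl
    simp [fidelity_eq_norm_transitionMatrix_sq, one_apply_ne hjk] at ht
  obtain ⟨p, hp⟩ := exists_int_mul_sub_eq_mul_pi hH hS ht ha hb
  obtain ⟨r, hr⟩ := exists_int_mul_sub_eq_mul_pi hH hS ht hc hd
  have hr₀ : (r : ℝ) ≠ 0 := by
    intro hr₀
    rw [hr₀, zero_mul] at hr
    exact mul_ne_zero ht₀ (sub_ne_zero.mpr hcd) hr
  refine ⟨p / r, ?_⟩
  push_cast
  rw [div_mul_eq_mul_div, eq_div_iff hr₀]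
  apply mul_left_cancel₀ ht₀
  linear_combination (r : ℝ) * hp - p * hr

omit [DecidableEq V] in
theorem isIntegral_of_mem_eigenvalueSupport {M : Matrix V V ℤ} {μ : ℝ}
    (hμ : μ ∈ eigenvalueSupport (M.map (Int.castRingHom ℂ)) j) : IsIntegral ℤ μ := by
  classical
  obtain ⟨w, hw, hwj⟩ := hμ
  have hdet : (scalar V (μ : ℂ) - M.map (Int.castRingHom ℂ)).det = 0 := by
    refine exists_mulVec_eq_zero_iff.mp ⟨w, fun h => hwj (congrFun h j), ?_⟩
    rw [sub_mulVec, hw, scalar_apply, ← smul_one_eq_diagonal, smul_mulVec, one_mulVec, sub_self]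
  have hroot : IsIntegral ℤ (μ : ℂ) := by
    refine ⟨M.charpoly, M.charpoly_monic, ?_⟩
    rwa [algebraMap_int_eq, ← Polynomial.eval_map, ← charpoly_map, eval_charpoly]
  exact (isIntegral_algebraMap_iff Complex.ofReal_injective).mp hroot

theorem HasPST.exists_int_eq_of_mem_eigenvalueSupport {M : Matrix V V ℤ} (hM : M.IsSymm)
    (h : HasPST (M.map (Int.castRingHom ℂ)) j k) {m n : ℤ} (hmn : m ≠ n)
    (hm : (m : ℝ) ∈ eigenvalueSupport (M.map (Int.castRingHom ℂ)) j)
    (hn : (n : ℝ) ∈ eigenvalueSupport (M.map (Int.castRingHom ℂ)) j)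
    {μ : ℝ} (hμ : μ ∈ eigenvalueSupport (M.map (Int.castRingHom ℂ)) j) : ∃ l : ℤ, μ = l := by
  have hS : (M.map (Int.castRingHom ℂ)).IsSymm := hM.map _
  have hH : (M.map (Int.castRingHom ℂ)).IsHermitian := by
    ext a b
    simp [hM.apply a b]
  obtain ⟨q, hq⟩ := h.exists_rat_sub_eq_mul_sub hH hS hμ hn hm hn (by exact_mod_cast hmn)
  obtain ⟨r, rfl⟩ : ∃ r : ℚ, μ = r :=
    ⟨n + q * (m - n), by push_cast; linear_combination hq⟩
  have hr : IsIntegral ℤ r :=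
    (isIntegral_algebraMap_iff (algebraMap ℚ ℝ).injective).mp
      (isIntegral_of_mem_eigenvalueSupport hμ)
  obtain ⟨l, rfl⟩ := IsIntegrallyClosed.isIntegral_iff.mp hr
  exact ⟨l, by simp⟩

end RatioCondition

section CubeGrading

variable {V R : Type*} [Fintype V] [Semiring R] {n : ℕ} {δ : V → ℕ}

/-- `δ` behaves under `A` like the distance from a vertex of the `n`-cube: a vertex at level `δ v`
has `δ v` neighbours one level below and `n - δ v` neighbours one level above. This is encoded as
the action of `A` on the functions that depend only on the level, in which the value of
`f (δ v - 1)` is irrelevant at level `0`. -/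
structure IsCubeGrading (A : Matrix V V R) (n : ℕ) (δ : V → ℕ) : Prop where
  le (v : V) : δ v ≤ n
  mulVec_comp (f : ℕ → R) (v : V) :
    (A *ᵥ (f ∘ δ)) v = δ v * f (δ v - 1) + (n - δ v : ℕ) * f (δ v + 1)

theorem isCubeGrading_adjMatrix {G : SimpleGraph V} [DecidableRel G.Adj]
    (hadj : ∀ v w, G.Adj v w → δ w + 1 = δ v ∨ δ w = δ v + 1)
    (hdown : ∀ v, {w | G.Adj v w ∧ δ w + 1 = δ v}.toFinset.card = δ v)
    (hup : ∀ v, {w | G.Adj v w ∧ δ w = δ v + 1}.toFinset.card + δ v = n) :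
    IsCubeGrading (G.adjMatrix R) n δ where
  le v := by linarith [hup v]
  mulVec_comp f v := by
    have hsplit (w : V) : G.adjMatrix R v w * f (δ w) =
        (if G.Adj v w ∧ δ w + 1 = δ v then f (δ v - 1) else 0) +
          if G.Adj v w ∧ δ w = δ v + 1 then f (δ v + 1) else 0 := by
      by_cases hvw : G.Adj v w
      · rcases hadj v w hvw with h | h
        · simp [hvw, ← h, add_assoc]
        · simp [hvw, h, add_assoc]
      · simp [hvw]
    have hup' : n - δ v = {w | G.Adj v w ∧ δ w = δ v + 1}.toFinset.card := by
      rw [← hup v, Nat.add_sub_cancel]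
    rw [hup']
    nth_rw 1 [← hdown v]
    simp only [mulVec, dotProduct, Function.comp_apply, hsplit, Finset.sum_add_distrib,
      ← Finset.sum_filter, Finset.sum_const, nsmul_eq_mul, Set.toFinset_ofPred]

theorem IsCubeGrading.sub {A : Matrix V V R} (h : IsCubeGrading A n δ) :
    IsCubeGrading A n (fun v => n - δ v) where
  le v := Nat.sub_le _ _
  mulVec_comp f v := by
    have hdown : (δ v : R) * f (n - (δ v - 1)) = δ v * f (n - δ v + 1) := by
      rcases Nat.eq_zero_or_pos (δ v) with h₀ | h₀
      · simp [h₀]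
      · rw [tsub_tsub_assoc (h.le v) h₀]
    rw [Nat.sub_sub_self (h.le v), Nat.sub_sub, add_comm, ← hdown]
    exact h.mulVec_comp (fun d => f (n - d)) v

theorem IsCubeGrading.fromBlocks_one [DecidableEq V] {A B : Matrix V V R} (hA : IsCubeGrading A n δ)
    (hB : IsCubeGrading B n δ) :
    IsCubeGrading (fromBlocks A 1 1 B) (n + 1) (Sum.elim δ fun v => δ v + 1) where
  le := by
    rintro (v | v)
    · exact (hA.le v).trans n.le_succ
    · exact Nat.succ_le_succ (hA.le v)
  mulVec_comp f := by
    have hinl : (f ∘ Sum.elim δ fun v => δ v + 1) ∘ Sum.inl = f ∘ δ := rfl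
    have hinr : (f ∘ Sum.elim δ fun v => δ v + 1) ∘ Sum.inr = (fun d => f (d + 1)) ∘ δ := rfl
    rintro (v | v)
    · rw [fromBlocks_mulVec, hinl, hinr, one_mulVec, Sum.elim_inl, Pi.add_apply, hA.mulVec_comp,
        Sum.elim_inl, Nat.sub_add_comm (hA.le v), Nat.cast_succ, add_one_mul, add_assoc]
      rfl
    · have hdown : (δ v : R) * f (δ v - 1 + 1) = δ v * f (δ v) := by
        rcases Nat.eq_zero_or_pos (δ v) with h₀ | h₀
        · simp [h₀]
        · rw [Nat.sub_add_cancel h₀]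
      rw [fromBlocks_mulVec, hinl, hinr, one_mulVec, Sum.elim_inr, Pi.add_apply, hB.mulVec_comp,
        hdown, Sum.elim_inr, Nat.add_sub_cancel, Nat.add_sub_add_right, Nat.cast_succ, add_one_mul,
        one_mulVec, Function.comp_apply, add_left_comm, add_assoc, add_assoc]

end CubeGrading

section CubeGradingWalk

variable {V : Type*} [Fintype V] {A : Matrix V V ℂ} {n : ℕ} {δ : V → ℕ}

namespace IsCubeGrading

theorem natCast_mem_eigenvalueSupport (h : IsCubeGrading A n δ) (j : V) :
    (n : ℝ) ∈ eigenvalueSupport A j := by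
  refine ⟨1, funext fun v => ?_, one_ne_zero⟩
  have hv := h.mulVec_comp 1 v
  rw [Pi.one_apply, Pi.one_apply, mul_one, mul_one, Nat.cast_sub (h.le v)] at hv
  simpa using hv

theorem neg_natCast_mem_eigenvalueSupport (h : IsCubeGrading A n δ) (j : V) :
    -(n : ℝ) ∈ eigenvalueSupport A j := by
  refine ⟨(fun d => (-1) ^ d) ∘ δ, funext fun v => ?_, pow_ne_zero _ (by norm_num)⟩
  rw [h.mulVec_comp, Nat.cast_sub (h.le v), Pi.smul_apply, Function.comp_apply]
  rcases δ v with _ | d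
  · simp
  · rw [Nat.add_sub_cancel]
    push_cast
    rw [smul_eq_mul]
    ring

/- The amplitudes factor over the `n` coordinates of the cube: each coordinate contributes
`cos t` if it is kept and `i sin t` if it is flipped. -/
theorem transitionMatrix_mulVec_single [DecidableEq V] (h : IsCubeGrading A n δ) {u : V}
    (hu : ∀ v, δ v = 0 ↔ v = u) (t : ℝ) :
    transitionMatrix A t *ᵥ Pi.single u 1 =
      fun v => (Real.cos t : ℂ) ^ (n - δ v) * (Complex.I * Real.sin t) ^ δ v := by
  set f : ℝ → ℕ → ℂ := fun s d => (Real.cos s : ℂ) ^ (n - d) * (Complex.I * Real.sin s) ^ d with hf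
  have hcos (s : ℝ) : HasDerivAt (fun s : ℝ => (Real.cos s : ℂ)) (-Real.sin s : ℂ) s := by
    simpa using (Real.hasDerivAt_cos s).ofReal_comp
  have hsin (s : ℝ) : HasDerivAt (fun s : ℝ => Complex.I * Real.sin s) (Complex.I * Real.cos s) s :=
    (Real.hasDerivAt_sin s).ofReal_comp.const_mul Complex.I
  have hderiv (s : ℝ) : HasDerivAt (fun s => f s ∘ δ) ((Complex.I • A) *ᵥ (f s ∘ δ)) s := by
    refine hasDerivAt_pi.mpr fun v => ?_
    rw [smul_mulVec, Pi.smul_apply, h.mulVec_comp]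
    refine (((hcos s).pow (n - δ v)).mul ((hsin s).pow (δ v))).congr_deriv ?_
    have hdown : (δ v : ℂ) * (Real.cos s : ℂ) ^ (n - (δ v - 1)) =
        δ v * (Real.cos s * (Real.cos s : ℂ) ^ (n - δ v)) := by
      rcases Nat.eq_zero_or_pos (δ v) with h₀ | h₀
      · simp [h₀]
      · rw [tsub_tsub_assoc (h.le v) h₀, pow_succ']
    simp only [hf, smul_eq_mul, ← Nat.sub_sub, Pi.pow_apply]
    linear_combination -(Complex.I * (Complex.I * Real.sin s) ^ (δ v - 1)) * hdown -
      (n - δ v : ℕ) * (Real.cos s : ℂ) ^ (n - δ v - 1) * Real.sin s *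
        (Complex.I * Real.sin s) ^ δ v * Complex.I_sq
  have hinit : f 0 ∘ δ = Pi.single u 1 := by
    ext v
    simp [hf, zero_pow_eq, hu, Pi.single_apply]
  rw [← hinit]
  exact transitionMatrix_mulVec_eq_of_hasDerivAt hderiv t

theorem hasPST [DecidableEq V] (h : IsCubeGrading A n δ) (hn : n ≠ 0) {u w : V}
    (hu : ∀ v, δ v = 0 ↔ v = u) (hw : δ w = n) : HasPST A w u := by
  refine ⟨?_, Real.pi / 2, ?_⟩
  · rintro rfl
    exact hn (hw.symm.trans ((hu w).mpr rfl))
  · have hentry := congrFun (h.transitionMatrix_mulVec_single hu (Real.pi / 2)) w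
    rw [mulVec_single_one, col_apply, hw, Nat.sub_self, pow_zero, one_mul, Real.sin_pi_div_two,
      Complex.ofReal_one, mul_one] at hentry
    rw [fidelity_eq_norm_transitionMatrix_sq, hentry, norm_pow, Complex.norm_I, one_pow, one_pow]

end IsCubeGrading

end CubeGradingWalk

section PartiallySwitchedCube

variable {R : Type*}

theorem map_intCastRingHom_adjMatrix [Ring R] {V : Type*} (G : SimpleGraph V)
    [DecidableRel G.Adj] :
    (G.adjMatrix ℤ).map (Int.castRingHom R) = G.adjMatrix R := by
  ext v w
  by_cases h : G.Adj v w <;> simp [h]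

theorem fromBlocks_one_mulVec_elim_mulVec [CommSemiring R] {V m : Type*} [Fintype V]
    [DecidableEq V] [Fintype m] {A B : Matrix V V R} {P : Matrix V m R} {S T : Matrix m m R}
    (hA : A * P = P * S) (hB : B * P = P * T) {μ : R} {a b : m → R} (ha : S *ᵥ a + b = μ • a)
    (hb : a + T *ᵥ b = μ • b) :
    fromBlocks A 1 1 B *ᵥ Sum.elim (P *ᵥ a) (P *ᵥ b) = μ • Sum.elim (P *ᵥ a) (P *ᵥ b) := by
  have hfirst : A *ᵥ P *ᵥ a + P *ᵥ b = μ • P *ᵥ a := by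
    rw [mulVec_mulVec, hA, ← mulVec_mulVec, ← mulVec_add, ha, mulVec_smul]
  have hsecond : P *ᵥ a + B *ᵥ P *ᵥ b = μ • P *ᵥ b := by
    rw [mulVec_mulVec, hB, ← mulVec_mulVec, ← mulVec_add, hb, mulVec_smul]
  rw [fromBlocks_mulVec, Sum.elim_comp_inl, Sum.elim_comp_inr, one_mulVec, one_mulVec, hfirst,
    hsecond]
  ext (v | v) <;> rfl

/-- The adjacency matrix of the partially switched 5-cube with integer entries, its vertices being
those of the two blocks. -/
def partiallySwitchedMatrix : Matrix (Fin 16 ⊕ Fin 16) (Fin 16 ⊕ Fin 16) ℤ :=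
  fromBlocks (Q4.adjMatrix ℤ) 1 1 (switchedQ4.adjMatrix ℤ)

theorem isSymm_partiallySwitchedMatrix : partiallySwitchedMatrix.IsSymm :=
  (SimpleGraph.isSymm_adjMatrix Q4).fromBlocks transpose_one
    (SimpleGraph.isSymm_adjMatrix switchedQ4)

theorem map_partiallySwitchedMatrix :
    partiallySwitchedMatrix.map (Int.castRingHom ℂ) = fromBlocks A41 1 1 A42 := by
  rw [partiallySwitchedMatrix, A41, A42, fromBlocks_map, map_intCastRingHom_adjMatrix,
    map_intCastRingHom_adjMatrix, Matrix.map_one _ (map_zero _) (map_one _)]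

/-- The size of the subset of `{a, b, c, d}` that belongs to a vertex of the 4-cube. -/
def level (v : Fin 16) : ℕ :=
  (Finset.univ.filter fun b => cubeLabel v b = true).card

theorem isCubeGrading_A41 : IsCubeGrading A41 4 level :=
  isCubeGrading_adjMatrix (by decide +kernel) (by decide +kernel) (by decide +kernel)

theorem isCubeGrading_A42 : IsCubeGrading A42 4 level :=
  isCubeGrading_adjMatrix (by decide +kernel) (by decide +kernel) (by decide +kernel)

/-- The value at a vertex of the 4-cube of the additive set function with weights `1, 2, 4, -7`.
The weights are chosen so that it vanishes only at the empty and at the full set. -/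
def setWeight (v : Fin 16) : ℤ :=
  ∑ b, if cubeLabel v b = true then (![1, 2, 4, -7] : Fin 4 → ℤ) b else 0

/-- The restrictions of `setWeight` to the levels `1, 2, 3`, as columns. -/
def weightMatrix : Matrix (Fin 16) (Fin 3) ℤ :=
  of fun v i => if level v = i + 1 then setWeight v else 0

/-- The action of the 4-cube on the columns of `weightMatrix`. -/
def cubeAction : Matrix (Fin 3) (Fin 3) ℤ :=
  !![0, 2, 0; 1, 0, 1; 0, 2, 0]

/-- The action of the switched 4-cube on the columns of `weightMatrix`. -/
def switchedAction : Matrix (Fin 3) (Fin 3) ℤ :=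
  !![0, -2, 0; -1, 0, 1; 0, 2, 0]

theorem adjMatrix_Q4_mul_weightMatrix :
    Q4.adjMatrix ℤ * weightMatrix = weightMatrix * cubeAction := by
  decide +kernel

theorem adjMatrix_switchedQ4_mul_weightMatrix :
    switchedQ4.adjMatrix ℤ * weightMatrix = weightMatrix * switchedAction := by
  decide +kernel

theorem weightMatrix_mulVec_apply [Ring R] {v : Fin 16} {i : Fin 3} (hv : level v = i + 1)
    (a : Fin 3 → R) :
    (weightMatrix.map (Int.castRingHom R) *ᵥ a) v = setWeight v * a i := by
  have hoff (l : Fin 3) (hl : l ≠ i) : level v ≠ l + 1 := by omega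
  rw [mulVec, dotProduct, Fintype.sum_eq_single i fun l hl => by simp [weightMatrix, hoff l hl]]
  simp [weightMatrix, hv]

/-- The coefficients on the first block of an eigenvector with eigenvalue `x`, with respect to the
columns of `weightMatrix`. They span the kernel of `(x - switchedAction) * (x - cubeAction) - 1`. -/
def cubeCoeff [CommRing R] (x : R) : Fin 3 → R :=
  ![8 * x, (x ^ 2 - 1) ^ 2, 4 * x * (x ^ 2 - 3)]

/-- The coefficients on the second block of an eigenvector with eigenvalue `x`, with respect to the
columns of `weightMatrix`. The first block row forces them to be
`(x - cubeAction) *ᵥ cubeCoeff x`. -/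
def switchedCoeff [CommRing R] (x : R) : Fin 3 → R :=
  ![8 * x ^ 2 - 2 * (x ^ 2 - 1) ^ 2, x * (x ^ 2 - 1) * (x ^ 2 - 5), 2 * x ^ 4 - 8 * x ^ 2 - 2]

theorem cubeAction_mulVec [Ring R] (a : Fin 3 → R) :
    cubeAction.map (Int.castRingHom R) *ᵥ a = ![2 * a 1, a 0 + a 2, 2 * a 1] := by
  ext i
  fin_cases i <;> simp [cubeAction, mulVec, dotProduct, Fin.sum_univ_three]

theorem switchedAction_mulVec [Ring R] (b : Fin 3 → R) :
    switchedAction.map (Int.castRingHom R) *ᵥ b = ![-2 * b 1, -b 0 + b 2, 2 * b 1] := by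
  ext i
  fin_cases i <;> simp [switchedAction, mulVec, dotProduct, Fin.sum_univ_three]

theorem cubeAction_mulVec_cubeCoeff [CommRing R] (x : R) :
    cubeAction.map (Int.castRingHom R) *ᵥ cubeCoeff x + switchedCoeff x = x • cubeCoeff x := by
  rw [cubeAction_mulVec]
  ext i
  fin_cases i
  · change 2 * (x ^ 2 - 1) ^ 2 + (8 * x ^ 2 - 2 * (x ^ 2 - 1) ^ 2) = x * (8 * x)
    ring
  · change 8 * x + 4 * x * (x ^ 2 - 3) + x * (x ^ 2 - 1) * (x ^ 2 - 5) = x * (x ^ 2 - 1) ^ 2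
    ring
  · change 2 * (x ^ 2 - 1) ^ 2 + (2 * x ^ 4 - 8 * x ^ 2 - 2) = x * (4 * x * (x ^ 2 - 3))
    ring

theorem switchedAction_mulVec_switchedCoeff [CommRing R] {x : R}
    (hx : x ^ 6 - 11 * x ^ 4 + 27 * x ^ 2 - 1 = 0) :
    cubeCoeff x + switchedAction.map (Int.castRingHom R) *ᵥ switchedCoeff x =
      x • switchedCoeff x := by
  rw [switchedAction_mulVec]
  ext i
  fin_cases i
  · change 8 * x + -2 * (x * (x ^ 2 - 1) * (x ^ 2 - 5)) = x * (8 * x ^ 2 - 2 * (x ^ 2 - 1) ^ 2)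
    ring
  · change (x ^ 2 - 1) ^ 2 + (-(8 * x ^ 2 - 2 * (x ^ 2 - 1) ^ 2) + (2 * x ^ 4 - 8 * x ^ 2 - 2)) =
      x * (x * (x ^ 2 - 1) * (x ^ 2 - 5))
    linear_combination -hx
  · change 4 * x * (x ^ 2 - 3) + 2 * (x * (x ^ 2 - 1) * (x ^ 2 - 5)) =
      x * (2 * x ^ 4 - 8 * x ^ 2 - 2)
    ring

theorem cubeCoeff_ne_zero {x : ℝ} (h₀ : 0 < x) (h₁ : x < 1 / 4) (i : Fin 3) :
    cubeCoeff (x : ℂ) i ≠ 0 := by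
  have hsq : x ^ 2 < 1 := by nlinarith
  have hfirst : 8 * x ≠ 0 := by positivity
  have hmid : (x ^ 2 - 1) ^ 2 ≠ 0 := pow_ne_zero _ (by linarith)
  have hlast : 4 * x * (x ^ 2 - 3) ≠ 0 := mul_ne_zero (by positivity) (by linarith)
  fin_cases i
  exacts [show 8 * (x : ℂ) ≠ 0 from mod_cast hfirst,
    show ((x : ℂ) ^ 2 - 1) ^ 2 ≠ 0 from mod_cast hmid,
    show 4 * (x : ℂ) * ((x : ℂ) ^ 2 - 3) ≠ 0 from mod_cast hlast]

theorem switchedCoeff_ne_zero {x : ℝ} (h₀ : 0 < x) (h₁ : x < 1 / 4) (i : Fin 3) :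
    switchedCoeff (x : ℂ) i ≠ 0 := by
  have hsq : x ^ 2 < 1 / 16 := by nlinarith
  have hfirst : 8 * x ^ 2 - 2 * (x ^ 2 - 1) ^ 2 ≠ 0 := by nlinarith
  have hmid : x * (x ^ 2 - 1) * (x ^ 2 - 5) ≠ 0 :=
    mul_ne_zero (mul_ne_zero h₀.ne' (by linarith)) (by linarith)
  have hlast : 2 * x ^ 4 - 8 * x ^ 2 - 2 ≠ 0 := by nlinarith [sq_nonneg x]
  fin_cases i
  exacts [show 8 * (x : ℂ) ^ 2 - 2 * ((x : ℂ) ^ 2 - 1) ^ 2 ≠ 0 from mod_cast hfirst,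
    show (x : ℂ) * ((x : ℂ) ^ 2 - 1) * ((x : ℂ) ^ 2 - 5) ≠ 0 from mod_cast hmid,
    show 2 * (x : ℂ) ^ 4 - 8 * (x : ℂ) ^ 2 - 2 ≠ 0 from mod_cast hlast]

theorem exists_root_mem_Ioo :
    ∃ x ∈ Set.Ioo (0 : ℝ) (1 / 4), x ^ 6 - 11 * x ^ 4 + 27 * x ^ 2 - 1 = 0 := by
  have hcont : ContinuousOn (fun x : ℝ => x ^ 6 - 11 * x ^ 4 + 27 * x ^ 2 - 1)
      (Set.Icc 0 (1 / 4)) := by fun_prop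
  exact intermediate_value_Ioo (by norm_num) hcont (by constructor <;> norm_num)

theorem partiallySwitchedMatrix_mulVec_elim [CommRing R] {x : R}
    (hx : x ^ 6 - 11 * x ^ 4 + 27 * x ^ 2 - 1 = 0) :
    partiallySwitchedMatrix.map (Int.castRingHom R) *ᵥ
        Sum.elim (weightMatrix.map (Int.castRingHom R) *ᵥ cubeCoeff x)
          (weightMatrix.map (Int.castRingHom R) *ᵥ switchedCoeff x) =
      x • Sum.elim (weightMatrix.map (Int.castRingHom R) *ᵥ cubeCoeff x)
        (weightMatrix.map (Int.castRingHom R) *ᵥ switchedCoeff x) := by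
  rw [partiallySwitchedMatrix, fromBlocks_map, Matrix.map_one _ (map_zero _) (map_one _)]
  refine fromBlocks_one_mulVec_elim_mulVec ?_ ?_ (cubeAction_mulVec_cubeCoeff x)
    (switchedAction_mulVec_switchedCoeff hx)
  · rw [← Matrix.map_mul, adjMatrix_Q4_mul_weightMatrix, Matrix.map_mul]
  · rw [← Matrix.map_mul, adjMatrix_switchedQ4_mul_weightMatrix, Matrix.map_mul]

theorem mem_eigenvalueSupport_partiallySwitchedMatrix {x : ℝ} (h₀ : 0 < x) (h₁ : x < 1 / 4)
    (hx : x ^ 6 - 11 * x ^ 4 + 27 * x ^ 2 - 1 = 0) {j : Fin 16 ⊕ Fin 16}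
    (hj : j ∉ ({.inl 0, .inl 15, .inr 0, .inr 15} : Finset (Fin 16 ⊕ Fin 16))) :
    x ∈ eigenvalueSupport (partiallySwitchedMatrix.map (Int.castRingHom ℂ)) j := by
  have hinterior : ∀ j ∉ ({.inl 0, .inl 15, .inr 0, .inr 15} : Finset (Fin 16 ⊕ Fin 16)),
      ∃ i : Fin 3, level (j.elim id id) = i + 1 ∧ setWeight (j.elim id id) ≠ 0 := by
    decide +kernel
  obtain ⟨i, hi, hweight⟩ := hinterior j hj
  refine ⟨_, partiallySwitchedMatrix_mulVec_elim (mod_cast hx), ?_⟩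
  rcases j with v | v
  · rw [Sum.elim_inl, weightMatrix_mulVec_apply (v := v) hi]
    exact mul_ne_zero (Int.cast_ne_zero.mpr hweight) (cubeCoeff_ne_zero h₀ h₁ i)
  · rw [Sum.elim_inr, weightMatrix_mulVec_apply (v := v) hi]
    exact mul_ne_zero (Int.cast_ne_zero.mpr hweight) (switchedCoeff_ne_zero h₀ h₁ i)

theorem not_hasPST_fromBlocks_A41_A42 {j : Fin 16 ⊕ Fin 16}
    (hj : j ∉ ({.inl 0, .inl 15, .inr 0, .inr 15} : Finset (Fin 16 ⊕ Fin 16)))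
    (k : Fin 16 ⊕ Fin 16) : ¬ HasPST (fromBlocks A41 1 1 A42) j k := by
  intro h
  have hgrading := isCubeGrading_A41.fromBlocks_one isCubeGrading_A42
  rw [← map_partiallySwitchedMatrix] at h hgrading
  have hpos := hgrading.natCast_mem_eigenvalueSupport j
  have hneg := hgrading.neg_natCast_mem_eigenvalueSupport j
  obtain ⟨x, ⟨h₀, h₁⟩, hx⟩ := exists_root_mem_Ioo
  obtain ⟨l, rfl⟩ := h.exists_int_eq_of_mem_eigenvalueSupport isSymm_partiallySwitchedMatrix
    (m := 5) (n := -5) (by norm_num) (mod_cast hpos) (mod_cast hneg)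
    (mem_eigenvalueSupport_partiallySwitchedMatrix h₀ h₁ hx hj)
  have hl₀ : 0 < l := mod_cast h₀
  have hl₁ : l < 1 := by exact_mod_cast h₁.trans (by norm_num : (1 / 4 : ℝ) < 1)
  omega

theorem hasPST_inr_fifteen_inl_zero :
    HasPST (fromBlocks A41 1 1 A42) (.inr 15) (.inl 0) :=
  (isCubeGrading_A41.fromBlocks_one isCubeGrading_A42).hasPST (by norm_num) (by decide +kernel)
    (by decide +kernel)

theorem hasPST_inr_zero_inl_fifteen :
    HasPST (fromBlocks A41 1 1 A42) (.inr 0) (.inl 15) :=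
  (isCubeGrading_A41.sub.fromBlocks_one isCubeGrading_A42.sub).hasPST (by norm_num)
    (by decide +kernel) (by decide +kernel)

theorem pstVertices_fromBlocks_A41_A42 :
    pstVertices (fromBlocks A41 1 1 A42) =
      ({.inl 0, .inl 15, .inr 0, .inr 15} : Finset (Fin 16 ⊕ Fin 16)) := by
  have hS : (fromBlocks A41 1 1 A42).IsSymm := by
    rw [← map_partiallySwitchedMatrix]
    exact isSymm_partiallySwitchedMatrix.map _
  ext j
  constructor
  · rintro ⟨k, hk⟩
    by_contra hj
    exact not_hasPST_fromBlocks_A41_A42 hj k hk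
  · intro hj
    simp only [Finset.coe_insert, Finset.coe_singleton, Set.mem_insert_iff,
      Set.mem_singleton_iff] at hj
    rcases hj with rfl | rfl | rfl | rfl
    exacts [⟨_, hasPST_inr_fifteen_inl_zero.symm hS⟩, ⟨_, hasPST_inr_zero_inl_fifteen.symm hS⟩,
      ⟨_, hasPST_inr_zero_inl_fifteen⟩, ⟨_, hasPST_inr_fifteen_inl_zero⟩]

theorem pstVertices_A53 : pstVertices A53 = ({0, 15, 16, 31} : Finset (Fin 32)) := by
  rw [A53, pstVertices_reindex, pstVertices_fromBlocks_A41_A42, ← Equiv.coe_toEmbedding,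
    ← Finset.coe_map]
  exact congrArg _ (by decide)

end PartiallySwitchedCube

theorem mainTheorem4 :
    pstVertices A53 = {v : Fin 32 | (v : ℕ) + 1 ∈ ({1, 16, 17, 32} : Set ℕ)} ∧
      ((pstVertices A53).ncard : ℚ) / (Fintype.card (Fin 32) : ℚ) = 1 / 8 := by
  rw [pstVertices_A53]
  constructor
  · ext v
    simp only [Finset.coe_insert, Finset.coe_singleton, Set.mem_insert_iff,
      Set.mem_singleton_iff, Set.mem_ofPred_eq, Fin.ext_iff]
    simp
  · have hcard : ({0, 15, 16, 31} : Finset (Fin 32)).card = 4 := by decide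
    rw [Set.ncard_coe_finset, Fintype.card_fin, hcard]
    norm_num
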